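/- Let $m=m_n$ ($n\ge 1$) be positive integers with $n=o(m)$ and $m=o(n^2)$ as $n\to\infty$, let $p$ be the uniform distribution on $[m]=\{1,\dots,m\}$, i.e. $p_j=1/m$, and let $\gamma$ be a constant. Let ${\boldsymbol q}=(q^{(n)})_{n\ge1}$ be a sequence of alternatives with likelihood ratio bounded by $\gamma$: $q^{(n)}$ is a probability mass function on $[m]$ with $\max_j q^{(n)}_j\le\gamma/m$ for every $n\ge 1$. For a probability mass function $\nu$ on $[m]$ let ${\sf P}_\nu,{\sf E}_\nu$ refer to i.i.d. observations $Z_1,\dots,Z_n$ with law $\nu$, and let $$S_n^*=-\#\{j\in[m] : \text{exactly one } i\in\{1,\dots,n\} \text{ satisfies } Z_i=j\}$$ be the statistic of the coincidence test. For real $\tau$ define the normalized missed-detection rate $$J_{\boldsymbol q}(\tau)=-\limsup_{n\to\infty}\frac{m}{n^2}\log {\sf P}_{q^{(n)}}\Big\{S_n^*\le {\sf E}_p[S_n^*]+\frac{n^2}{m}\tau\Big\}\in[-\infty,\infty],\qquad \log 0:=-\infty .$$ **Theorem.** For every real $\tau\neq-1$, $$J_{\boldsymbol q}(\tau)=\sup_{\theta\ge0}\Big\{\theta(-1-\tau)-\tfrac12\big(e^{-2\theta}-1\big)\kappa({\boldsymbol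 q})\Big\},\qquad \kappa({\boldsymbol q})=\liminf_{n\to\infty}\sum_{j=1}^{m}\frac{(q^{(n)}_j)^2}{p_j},$$ as an equality in $[-\infty,\infty]$ (both sides are $+\infty$ when $\tau<-1$). -/

import Mathlib

namespace Coincidence

/-- The uniform probability mass function on an alphabet with `m` symbols. -/
noncomputable def unif (m : ℕ) : Fin m → ℝ := fun _ => 1 / (m : ℝ)

/-- The probability mass functions `q` on `m` symbols whose likelihood ratio with respect to the
uniform distribution is bounded by `γ`, that is, `max_j q_j ≤ γ / m`. -/
def boundedPmf (γ : ℝ) (m : ℕ) : Set (Fin m → ℝ) :=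
  {q | q ∈ stdSimplex ℝ (Fin m) ∧ ∀ j, q j ≤ γ / (m : ℝ)}

/-- The number of observations among `z_1, …, z_n` that are equal to the symbol `j`. -/
def count {n m : ℕ} (z : Fin n → Fin m) (j : Fin m) : ℕ :=
  (Finset.univ.filter fun i => z i = j).card

/-- The coincidence statistic: minus the number of symbols that appear exactly once. -/
def statistic {n m : ℕ} (z : Fin n → Fin m) : ℝ :=
  -∑ j : Fin m, if count z j = 1 then (1 : ℝ) else 0

/-- The expectation of `f (Z_1, …, Z_n)` for `Z_1, …, Z_n` i.i.d. with probability mass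
function `ν`. -/
def expect {m : ℕ} (ν : Fin m → ℝ) (n : ℕ) (f : (Fin n → Fin m) → ℝ) : ℝ :=
  ∑ z : Fin n → Fin m, (∏ i, ν (z i)) * f z

open Classical in
/-- The probability that `(Z_1, …, Z_n) ∈ A` for `Z_1, …, Z_n` i.i.d. with probability mass
function `ν`. -/
noncomputable def prob {m : ℕ} (ν : Fin m → ℝ) (n : ℕ) (A : Set (Fin n → Fin m)) : ℝ :=
  expect ν n fun z => if z ∈ A then 1 else 0

/-- The event that the statistic is at most its mean under the uniform distribution
plus `(n² / m) τ`. -/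
noncomputable def missEvent (n m : ℕ) (τ : ℝ) : Set (Fin n → Fin m) :=
  {z | statistic z ≤ expect (unif m) n statistic + (n : ℝ) ^ 2 / (m : ℝ) * τ}

/-- The normalized missed-detection rate
`- limsup_n (m / n²) log P_{q⁽ⁿ⁾} (S_n ≤ E_p[S_n] + (n² / m) τ)`,
an extended real number, with `log 0 = -∞`. -/
noncomputable def rate (m : ℕ → ℕ) (q : (n : ℕ) → Fin (m n) → ℝ) (τ : ℝ) : EReal :=
  -Filter.limsup
    (fun n : ℕ => (((m n : ℝ) / (n : ℝ) ^ 2 : ℝ) : EReal) *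
      ENNReal.log (ENNReal.ofReal (prob (q n) n (missEvent n (m n) τ))))
    Filter.atTop

/-- `κ(q) = liminf_n ∑_j (q_j⁽ⁿ⁾)² / p_j` with `p` uniform. For `q⁽ⁿ⁾` in `boundedPmf γ (m n)` the
sums lie between `1` and `γ`. -/
noncomputable def kappa (m : ℕ → ℕ) (q : (n : ℕ) → Fin (m n) → ℝ) : ℝ :=
  Filter.liminf (fun n : ℕ => ∑ j : Fin (m n), (q n j) ^ 2 / unif (m n) j) Filter.atTop

end Coincidence

namespace Coincidence

open Filter Topology
open scoped PowerSeries

/-! Write the statistic as minus `n` plus the excess, and set `r = n² / m`. Under the uniform law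
the mean excess is asymptotic to `r` (`tendsto_excess_mean`), so a missed detection means excess at
most about `(1 + τ) r`. Everything rests on the Laplace transform of the excess, whose logarithm is
`-r κ_n (1 - exp (-2θ)) / 2 + o(r)`, with `κ_n = kappaAt m q n`.

That asymptotic comes from Poissonization: with a Poisson number of observations the counts are
independent and the transform is an explicit product (`hasSum_laplace`). The excess never decreases
when an observation is added, so the transform is antitone in `n` and can be compared with Poisson
averages of mean `n (1 ∓ δ)` (`eventually_laplace_le`, `eventually_le_laplace`).

A Chernoff bound gives one inequality (`le_rate`), with `κ_n` eventually above `κ - ε`. For `τ > -1`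
the other follows by tilting: a mass estimate at the tilt `θ` (`eventually_le_prob_excess`), used
for the infinitely many `n` with `κ_n` near its liminf, and then `θ` is taken to the maximizer
(`exists_rate_le`). For `τ < -1` the supremum is already infinite. -/

/-! ### Expectations and occupancy counts. -/

theorem expect_zero {m : ℕ} (ν : Fin m → ℝ) (f : (Fin 0 → Fin m) → ℝ) :
    expect ν 0 f = f Fin.elim0 := by
  simp [expect, Subsingleton.elim (default : Fin 0 → Fin m) Fin.elim0]

theorem expect_succ {m : ℕ} (ν : Fin m → ℝ) (n : ℕ) (f : (Fin (n + 1) → Fin m) → ℝ) :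
    expect ν (n + 1) f = ∑ a, ν a * expect ν n fun z => f (Fin.cons a z) := by
  unfold expect
  rw [← (Fin.consEquiv fun _ : Fin (n + 1) => Fin m).sum_comp, Fintype.sum_prod_type]
  refine Finset.sum_congr rfl fun a _ => ?_
  rw [Finset.mul_sum]
  refine Finset.sum_congr rfl fun z _ => ?_
  simp [Fin.consEquiv, Fin.prod_univ_succ, mul_assoc]

theorem expect_mono {m : ℕ} {ν : Fin m → ℝ} (hν : ∀ j, 0 ≤ ν j) {n : ℕ}
    {f g : (Fin n → Fin m) → ℝ} (h : ∀ z, f z ≤ g z) : expect ν n f ≤ expect ν n g :=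
  Finset.sum_le_sum fun z _ =>
    mul_le_mul_of_nonneg_left (h z) (Finset.prod_nonneg fun i _ => hν (z i))

theorem expect_add {m : ℕ} (ν : Fin m → ℝ) {n : ℕ} (f g : (Fin n → Fin m) → ℝ) :
    (expect ν n fun z => f z + g z) = expect ν n f + expect ν n g := by
  simp [expect, mul_add, Finset.sum_add_distrib]

theorem expect_const_mul {m : ℕ} (ν : Fin m → ℝ) {n : ℕ} (c : ℝ) (f : (Fin n → Fin m) → ℝ) :
    (expect ν n fun z => c * f z) = c * expect ν n f := by
  simp only [expect, Finset.mul_sum]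
  exact Finset.sum_congr rfl fun z _ => by ring

theorem expect_const {m : ℕ} {ν : Fin m → ℝ} (hν : ∑ j, ν j = 1) (n : ℕ) (c : ℝ) :
    (expect ν n fun _ => c) = c := by
  induction n with
  | zero => exact expect_zero ν _
  | succ n ih => rw [expect_succ]; simp [ih, ← Finset.sum_mul, hν]

theorem expect_sum {m : ℕ} (ν : Fin m → ℝ) {n : ℕ} {ι : Type*} (s : Finset ι)
    (f : ι → (Fin n → Fin m) → ℝ) :
    (expect ν n fun z => ∑ i ∈ s, f i z) = ∑ i ∈ s, expect ν n (f i) := by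
  simp only [expect, Finset.mul_sum]
  exact Finset.sum_comm

theorem count_elim0 {m : ℕ} (z : Fin 0 → Fin m) (j : Fin m) : count z j = 0 := by
  simp [count]

theorem count_cons {n m : ℕ} (a : Fin m) (z : Fin n → Fin m) (j : Fin m) :
    count (Fin.cons a z : Fin (n + 1) → Fin m) j = (if a = j then 1 else 0) + count z j := by
  simp only [count, Finset.card_filter, Fin.sum_univ_succ, Fin.cons_zero, Fin.cons_succ]

theorem sum_count {n m : ℕ} (z : Fin n → Fin m) : ∑ j, count z j = n := by
  have := Finset.card_eq_sum_card_fiberwise (f := z) (s := Finset.univ) (t := Finset.univ)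
    (fun _ _ => Finset.mem_coe.2 (Finset.mem_univ _))
  simpa [count] using this.symm

theorem statistic_le_statistic_cons {n m : ℕ} (a : Fin m) (z : Fin n → Fin m) :
    statistic z ≤ 1 + statistic (Fin.cons a z : Fin (n + 1) → Fin m) := by
  unfold statistic
  have h : ∀ j, (if count (Fin.cons a z : Fin (n + 1) → Fin m) j = 1 then (1 : ℝ) else 0) ≤
      (if a = j then 1 else 0) + if count z j = 1 then (1 : ℝ) else 0 := by
    intro j
    rw [count_cons]
    by_cases ha : a = j
    · simp only [ha, if_true]
      split_ifs <;> norm_num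
    · simp [ha]
  have := Finset.sum_le_sum fun j (_ : j ∈ Finset.univ) => h j
  rw [Finset.sum_add_distrib] at this
  simp only [Finset.sum_ite_eq, Finset.mem_univ, if_true] at this
  linarith

/-! ### The excess and its Laplace transform. -/

/-- The number of observations whose value occurs at least twice. -/
noncomputable def excess {n m : ℕ} (z : Fin n → Fin m) : ℝ := n + statistic z

theorem excess_eq_sum {n m : ℕ} (z : Fin n → Fin m) :
    excess z = ∑ j, if count z j = 1 then (0 : ℝ) else count z j := by
  have h : (n : ℝ) = ∑ j, (count z j : ℝ) := by exact_mod_cast (sum_count z).symm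
  unfold excess statistic
  rw [← Finset.sum_neg_distrib, h, ← Finset.sum_add_distrib]
  exact Finset.sum_congr rfl fun j _ => by split_ifs with hj <;> simp [hj]

theorem excess_nonneg {n m : ℕ} (z : Fin n → Fin m) : 0 ≤ excess z := by
  rw [excess_eq_sum]
  exact Finset.sum_nonneg fun j _ => by split_ifs <;> positivity

/-- The Laplace transform of the excess. -/
noncomputable def laplace {m : ℕ} (ν : Fin m → ℝ) (θ : ℝ) (n : ℕ) : ℝ :=
  expect ν n fun z => Real.exp (-θ * excess z)

theorem laplace_nonneg {m : ℕ} {ν : Fin m → ℝ} (hν : ∀ j, 0 ≤ ν j) (θ : ℝ) (n : ℕ) :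
    0 ≤ laplace ν θ n :=
  Finset.sum_nonneg fun z _ => mul_nonneg (Finset.prod_nonneg fun i _ => hν (z i))
    (Real.exp_pos _).le

/-- One more observation creates at most one new singleton, so it cannot lower the excess. This
monotonicity is what makes depoissonization possible. -/
theorem laplace_antitone {m : ℕ} {ν : Fin m → ℝ} (hν : ν ∈ stdSimplex ℝ (Fin m)) {θ : ℝ}
    (hθ : 0 ≤ θ) : Antitone (laplace ν θ) := by
  refine antitone_nat_of_succ_le fun n => ?_
  unfold laplace
  rw [expect_succ]
  calc _ ≤ ∑ a, ν a * expect ν n fun z => Real.exp (-θ * excess z) := by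
        refine Finset.sum_le_sum fun a _ => mul_le_mul_of_nonneg_left
          (expect_mono hν.1 fun z => Real.exp_le_exp.2 ?_) (hν.1 a)
        have := statistic_le_statistic_cons a z
        unfold excess
        push_cast
        nlinarith
    _ = _ := by rw [← Finset.sum_mul, hν.2, one_mul]

theorem laplace_le_one {m : ℕ} {ν : Fin m → ℝ} (hν : ν ∈ stdSimplex ℝ (Fin m)) {θ : ℝ}
    (hθ : 0 ≤ θ) (n : ℕ) : laplace ν θ n ≤ 1 := by
  refine (expect_mono hν.1 fun z => ?_).trans_eq (expect_const hν.2 n 1)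
  rw [Real.exp_le_one_iff]
  nlinarith [excess_nonneg z]

/-! ### Generating series and Poissonization. -/

/-- The exponential generating series of `k ↦ f k * x ^ k`. -/
noncomputable def egf (f : ℕ → ℝ) (x : ℝ) : ℝ⟦X⟧ :=
  PowerSeries.mk fun k => f k * x ^ k / k.factorial

theorem derivative_egf (f : ℕ → ℝ) (x : ℝ) :
    PowerSeries.derivative ℝ (egf f x) = x • egf (fun k => f (k + 1)) x := by
  ext k
  simp only [egf, PowerSeries.coeff_derivative, PowerSeries.coeff_mk, map_smul, smul_eq_mul,
    Nat.factorial_succ]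
  push_cast
  field_simp
  ring

theorem derivative_prod {ι : Type*} [DecidableEq ι] (s : Finset ι) (F : ι → ℝ⟦X⟧) :
    PowerSeries.derivative ℝ (∏ i ∈ s, F i) =
      ∑ i ∈ s, (∏ j ∈ s.erase i, F j) * PowerSeries.derivative ℝ (F i) := by
  induction s using Finset.induction_on with
  | empty => simp
  | insert a s ha ih =>
    rw [Finset.prod_insert ha, Derivation.leibniz, ih, Finset.sum_insert ha,
      Finset.erase_insert ha, smul_eq_mul, smul_eq_mul, Finset.mul_sum, add_comm]
    congr 1
    refine Finset.sum_congr rfl fun i hi => ?_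
    have hia : a ≠ i := fun h => ha (h ▸ hi)
    rw [Finset.erase_insert_of_ne hia,
      Finset.prod_insert fun h => ha (Finset.mem_of_mem_erase h), mul_assoc]

/-- Conditioning on the first observation matches differentiating the product: if it equals `a`, the
factor of `a` gets weight `ν a` and its `f a` is shifted by one. -/
theorem expect_prod_count {m : ℕ} (ν : Fin m → ℝ) (n : ℕ) (f : Fin m → ℕ → ℝ) :
    (expect ν n fun z => ∏ j, f j (count z j)) =
      n.factorial * PowerSeries.coeff n (∏ j, egf (f j) (ν j)) := by
  induction n generalizing f with
  | zero =>
    rw [expect_zero]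
    simp [count_elim0, egf, map_prod]
  | succ n ih =>
    have h : ((n + 1).factorial : ℝ) * PowerSeries.coeff (n + 1) (∏ j, egf (f j) (ν j)) =
        n.factorial * PowerSeries.coeff n (PowerSeries.derivative ℝ (∏ j, egf (f j) (ν j))) := by
      rw [PowerSeries.coeff_derivative, Nat.factorial_succ]
      push_cast
      ring
    rw [h, expect_succ, derivative_prod, map_sum, Finset.mul_sum]
    refine Finset.sum_congr rfl fun a _ => ?_
    have h1 : ∀ z : Fin n → Fin m,
        ∏ j, f j (count (Fin.cons a z : Fin (n + 1) → Fin m) j) =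
        ∏ j, Function.update f a (fun k => f a (k + 1)) j (count z j) := fun z => by
      refine Finset.prod_congr rfl fun j _ => ?_
      rw [count_cons]
      by_cases hj : a = j
      · subst hj; simp [add_comm]
      · simp [hj, Function.update_of_ne (Ne.symm hj)]
    simp only [h1]
    rw [ih, derivative_egf, ← Finset.mul_prod_erase _ _ (Finset.mem_univ a),
      Function.update_self]
    have h2 : ∏ j ∈ Finset.univ.erase a, egf (Function.update f a (fun k => f a (k + 1)) j) (ν j)
        = ∏ j ∈ Finset.univ.erase a, egf (f j) (ν j) :=
      Finset.prod_congr rfl fun j hj => by rw [Function.update_of_ne (Finset.ne_of_mem_erase hj)]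
    rw [h2]
    simp only [smul_eq_mul, mul_smul_comm, map_smul, mul_comm (egf (fun k => f a (k + 1)) (ν a))]
    ring

theorem summable_coeff_mul {F G : ℝ⟦X⟧} {x : ℝ}
    (hF : Summable fun n => ‖PowerSeries.coeff n F * x ^ n‖)
    (hG : Summable fun n => ‖PowerSeries.coeff n G * x ^ n‖) :
    (Summable fun n => ‖PowerSeries.coeff n (F * G) * x ^ n‖) ∧
    ∑' n, PowerSeries.coeff n (F * G) * x ^ n =
      (∑' n, PowerSeries.coeff n F * x ^ n) * ∑' n, PowerSeries.coeff n G * x ^ n := by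
  have h : ∀ n, PowerSeries.coeff n (F * G) * x ^ n =
      ∑ kl ∈ Finset.HasAntidiagonal.antidiagonal n,
        (PowerSeries.coeff kl.1 F * x ^ kl.1) * (PowerSeries.coeff kl.2 G * x ^ kl.2) := by
    intro n
    rw [PowerSeries.coeff_mul, Finset.sum_mul]
    refine Finset.sum_congr rfl fun kl hkl => ?_
    rw [← Finset.HasAntidiagonal.mem_antidiagonal.1 hkl, pow_add]
    ring
  have h1 := summable_norm_sum_mul_antidiagonal_of_summable_norm hF hG
  have h2 := tsum_mul_tsum_eq_tsum_sum_antidiagonal_of_summable_norm hF hG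
  simp only [← h] at h1 h2
  exact ⟨h1, h2.symm⟩

theorem summable_coeff_prod {ι : Type*} (s : Finset ι) (F : ι → ℝ⟦X⟧) {x : ℝ}
    (hF : ∀ i ∈ s, Summable fun n => ‖PowerSeries.coeff n (F i) * x ^ n‖) :
    (Summable fun n => ‖PowerSeries.coeff n (∏ i ∈ s, F i) * x ^ n‖) ∧
    ∑' n, PowerSeries.coeff n (∏ i ∈ s, F i) * x ^ n =
      ∏ i ∈ s, ∑' n, PowerSeries.coeff n (F i) * x ^ n := by
  classical
  induction s using Finset.induction_on with
  | empty =>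
    simp only [Finset.prod_empty, PowerSeries.coeff_one]
    constructor
    · refine summable_of_ne_finset_zero (s := {0}) fun n hn => ?_
      simp_all
    · rw [tsum_eq_single 0 fun n hn => by simp [hn]]
      simp
  | insert i s hi ih =>
    obtain ⟨h1, h2⟩ := ih fun j hj => hF j (Finset.mem_insert_of_mem hj)
    rw [Finset.prod_insert hi, Finset.prod_insert hi, ← h2]
    exact summable_coeff_mul (hF i (Finset.mem_insert_self i s)) h1

theorem hasSum_egf_singleton (v y : ℝ) :
    HasSum (fun k : ℕ => (if k = 1 then (1 : ℝ) else v ^ k) * y ^ k / k.factorial)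
      (Real.exp (v * y) + (1 - v) * y) := by
  have h1 : HasSum (fun k : ℕ => (v * y) ^ k / k.factorial) (Real.exp (v * y)) := by
    rw [Real.exp_eq_exp_ℝ]
    exact NormedSpace.expSeries_div_hasSum_exp (v * y)
  have h2 := hasSum_ite_eq 1 ((1 - v) * y)
  convert h1.add h2 using 2 with k
  by_cases hk : k = 1
  · subst hk; simp; ring
  · simp [hk, mul_pow]

/-- The exponential of the excess factors over symbols: a count `k` contributes `v ^ k`, except that
`k = 1` contributes `1`. Multiplied by `exp (-x)`, the identity gives the transform for a
Poisson(`x`) number of observations. -/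
theorem hasSum_laplace {m : ℕ} (ν : Fin m → ℝ) (θ x : ℝ) :
    HasSum (fun n : ℕ => laplace ν θ n * (x ^ n / n.factorial))
      (∏ j, (Real.exp (Real.exp (-θ) * (x * ν j)) + (1 - Real.exp (-θ)) * (x * ν j))) := by
  set v := Real.exp (-θ) with hv
  have hv0 : 0 < v := Real.exp_pos _
  let f : ℕ → ℝ := fun k => if k = 1 then (1 : ℝ) else v ^ k
  have h1 : ∀ n, laplace ν θ n * (x ^ n / n.factorial) =
      PowerSeries.coeff n (∏ j, egf f (ν j)) * x ^ n := by
    intro n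
    have : laplace ν θ n = expect ν n fun z => ∏ j, f (count z j) := by
      unfold laplace
      congr 1
      ext z
      rw [excess_eq_sum, Finset.mul_sum, Real.exp_sum]
      refine Finset.prod_congr rfl fun j _ => ?_
      by_cases hj : count z j = 1
      · simp [f, hj]
      · simp only [f, hj, if_false, hv]
        rw [← Real.exp_nat_mul, mul_comm]
    rw [this, expect_prod_count ν n fun _ => f]
    field_simp
  have h2 : ∀ j n, PowerSeries.coeff n (egf f (ν j)) * x ^ n =
      (if n = 1 then (1 : ℝ) else v ^ n) * (x * ν j) ^ n / n.factorial := by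
    intro j n
    simp only [egf, PowerSeries.coeff_mk, f, mul_pow]
    ring
  have h3 : ∀ j, HasSum (fun n => PowerSeries.coeff n (egf f (ν j)) * x ^ n)
      (Real.exp (v * (x * ν j)) + (1 - v) * (x * ν j)) := fun j => by
    simp only [h2]
    exact hasSum_egf_singleton v (x * ν j)
  obtain ⟨h4, h5⟩ := summable_coeff_prod Finset.univ (fun j => egf f (ν j)) (x := x)
    fun j _ => (h3 j).summable.norm
  simp only [h1]
  rw [Finset.prod_congr rfl fun j _ => (h3 j).tsum_eq.symm, ← h5]
  exact h4.of_norm.hasSum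

/-! ### Depoissonization of monotone sequences. -/

theorem hasSum_exp (x : ℝ) : HasSum (fun n : ℕ => x ^ n / n.factorial) (Real.exp x) := by
  rw [Real.exp_eq_exp_ℝ]
  exact NormedSpace.expSeries_div_hasSum_exp x

theorem hasSum_nat_mul_exp (x : ℝ) :
    HasSum (fun n : ℕ => n * (x ^ n / n.factorial)) (x * Real.exp x) := by
  rw [← hasSum_nat_add_iff' 1]
  simp only [Finset.range_one, Finset.sum_singleton, CharP.cast_eq_zero, zero_mul, sub_zero]
  refine ((hasSum_exp x).mul_left x).congr_fun fun n => ?_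
  rw [Nat.factorial_succ, pow_succ]
  push_cast
  field_simp

/-- A decreasing nonnegative sequence is controlled by its Poisson averages of smaller mean. -/
theorem mul_one_sub_le_of_antitone {a : ℕ → ℝ} (ha : Antitone a) (h0 : ∀ n, 0 ≤ a n) {x S : ℝ}
    (hx : 0 ≤ x) (hS : HasSum (fun k : ℕ => a k * (x ^ k / k.factorial)) S) {n : ℕ} (hn : 0 < n) :
    a n * (1 - x / n) ≤ Real.exp (-x) * S := by
  have hn' : (0 : ℝ) < n := by exact_mod_cast hn
  have h1 := ((hasSum_exp x).sub ((hasSum_nat_mul_exp x).div_const (n : ℝ))).mul_left (a n)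
  have h2 := hasSum_le (fun k => ?_) h1 hS
  · have h3 := mul_le_mul_of_nonneg_left h2 (Real.exp_pos (-x)).le
    refine le_trans (le_of_eq ?_) h3
    have : Real.exp (-x) * Real.exp x = 1 := by rw [← Real.exp_add]; simp
    linear_combination (-(a n * (1 - x / n))) * this
  · have hp : 0 ≤ x ^ k / k.factorial := by positivity
    -- A minorant linear in `k` suffices: monotonicity covers `k ≤ n`, and for `k ≥ n` the left side
    -- is nonpositive. Averaging it needs only the Poisson mean.
    have h4 : a n * (1 - k / n) ≤ a k := by
      rcases le_total k n with hk | hk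
      · have h5 := ha hk
        have : (0 : ℝ) ≤ k / n := by positivity
        nlinarith [h0 n]
      · have : (1 : ℝ) ≤ k / n := by rw [le_div_iff₀ hn']; simpa using hk
        nlinarith [h0 n, h0 k]
    calc _ = a n * (1 - k / n) * (x ^ k / k.factorial) := by ring
      _ ≤ _ := mul_le_mul_of_nonneg_right h4 hp

/-- A decreasing sequence in `[0, 1]` dominates its Poisson averages of larger mean, up to a
Chernoff bound for the Poisson lower tail. -/
theorem le_add_of_antitone {a : ℕ → ℝ} (ha : Antitone a) (h1 : ∀ n, a n ≤ 1) (h0 : ∀ n, 0 ≤ a n)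
    {x s S : ℝ} (hx : 0 ≤ x) (hs0 : 0 < s) (hs1 : s ≤ 1)
    (hS : HasSum (fun k : ℕ => a k * (x ^ k / k.factorial)) S) (n : ℕ) :
    Real.exp (-x) * S ≤ a n + s⁻¹ ^ n * Real.exp (x * (s - 1)) := by
  have h2 := ((hasSum_exp x).mul_left (a n)).add ((hasSum_exp (s * x)).mul_left (s⁻¹ ^ n))
  have h3 := hasSum_le (fun k => ?_) hS h2
  · refine (mul_le_mul_of_nonneg_left h3 (Real.exp_pos (-x)).le).trans (le_of_eq ?_)
    have e1 : Real.exp (-x) * Real.exp x = 1 := by rw [← Real.exp_add]; simp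
    have e2 : Real.exp (x * (s - 1)) = Real.exp (-x) * Real.exp (s * x) := by
      rw [← Real.exp_add]; ring_nf
    rw [e2]
    linear_combination (a n) * e1
  · have hp : 0 ≤ x ^ k / k.factorial := by positivity
    -- For `k < n` the Chernoff weight `s ^ k / s ^ n` is at least `1`, hence at least `a k`.
    have h4 : a k ≤ a n + s⁻¹ ^ n * s ^ k := by
      have hpos : 0 ≤ s⁻¹ ^ n * s ^ k := by positivity
      rcases le_total n k with hk | hk
      · linarith [ha hk]
      · have : 1 ≤ s⁻¹ ^ n * s ^ k := by
          obtain ⟨d, rfl⟩ := Nat.exists_eq_add_of_le hk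
          have h5 : s⁻¹ ^ (k + d) * s ^ k = s⁻¹ ^ d := by
            rw [pow_add, inv_pow]; field_simp
          rw [h5]
          exact one_le_pow₀ ((one_le_inv₀ hs0).2 hs1)
        linarith [h1 k, h0 n]
    calc _ ≤ (a n + s⁻¹ ^ n * s ^ k) * (x ^ k / k.factorial) :=
          mul_le_mul_of_nonneg_right h4 hp
      _ = _ := by rw [mul_pow]; ring

/-! ### Estimates for the Poisson product. -/

theorem exp_le_cubic {x : ℝ} (h0 : 0 ≤ x) (h1 : x ≤ 1) :
    Real.exp x ≤ 1 + x + x ^ 2 / 2 + x ^ 3 := by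
  have := Real.exp_bound' h0 h1 (n := 3) (by norm_num)
  simp only [Finset.sum_range_succ, Finset.range_zero, Finset.sum_empty] at this
  norm_num [Nat.factorial] at this
  have h3 : 0 ≤ x ^ 3 := by positivity
  linarith

/-- Both sides are `1 + u + v² u² / 2 + O(u³)`; the term `2 u³` absorbs the cubic errors. -/
theorem exp_add_le_exp {v u : ℝ} (hv0 : 0 ≤ v) (hv1 : v ≤ 1) (hu0 : 0 ≤ u) (hu1 : u ≤ 1) :
    Real.exp (v * u) + (1 - v) * u ≤
      Real.exp (u - (1 - v ^ 2) / 2 * u ^ 2 + 2 * u ^ 3) := by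
  have h1 := exp_le_cubic (mul_nonneg hv0 hu0) (mul_le_one₀ hv1 hu0 hu1)
  have hc0 : 0 ≤ 1 - v ^ 2 := by nlinarith
  have hc1 : 1 - v ^ 2 ≤ 1 := by nlinarith
  have hu3 : 0 ≤ u ^ 3 := by positivity
  have hv3 : (v * u) ^ 3 ≤ u ^ 3 := by
    refine pow_le_pow_left₀ (mul_nonneg hv0 hu0) ?_ 3
    nlinarith
  set c := 1 - v ^ 2 with hc
  have hw0 : 0 ≤ u - c / 2 * u ^ 2 := by nlinarith [mul_nonneg hu0 hu0]
  set w := u - c / 2 * u ^ 2 + 2 * u ^ 3 with hw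
  have h2 : 1 + w + w ^ 2 / 2 ≤ Real.exp w := Real.quadratic_le_exp_of_nonneg (by linarith)
  have h3 : (u - c / 2 * u ^ 2) ^ 2 ≤ w ^ 2 := pow_le_pow_left₀ hw0 (by linarith) 2
  have h4 : u ^ 2 - c * u ^ 3 ≤ (u - c / 2 * u ^ 2) ^ 2 := by nlinarith [sq_nonneg (c / 2 * u ^ 2)]
  have h5 : c * u ^ 3 ≤ u ^ 3 := by nlinarith
  have h6 : (v * u) ^ 2 = (1 - c) * u ^ 2 := by rw [hc]; ring
  nlinarith

theorem exp_le_exp_add {v u : ℝ} (hv0 : 0 ≤ v) (hv1 : v ≤ 1) (hu0 : 0 ≤ u) (hu1 : u ≤ 1) :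
    Real.exp (u - (1 - v ^ 2) / 2 * u ^ 2 - 2 * u ^ 3) ≤
      Real.exp (v * u) + (1 - v) * u := by
  have h1 := Real.quadratic_le_exp_of_nonneg (mul_nonneg hv0 hu0)
  have hc0 : 0 ≤ 1 - v ^ 2 := by nlinarith
  have hc1 : 1 - v ^ 2 ≤ 1 := by nlinarith
  have hu3 : 0 ≤ u ^ 3 := by positivity
  have h6 : (v * u) ^ 2 = (1 - (1 - v ^ 2)) * u ^ 2 := by ring
  set c := 1 - v ^ 2 with hc
  have hw0 : 0 ≤ u - c / 2 * u ^ 2 := by nlinarith [mul_nonneg hu0 hu0]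
  have hwu : u - c / 2 * u ^ 2 ≤ u := by nlinarith [mul_nonneg hu0 hu0]
  have h2 := exp_le_cubic hw0 (hwu.trans hu1)
  set w := u - c / 2 * u ^ 2 with hw
  have h3 : w ^ 2 ≤ u ^ 2 := pow_le_pow_left₀ hw0 hwu 2
  have h4 : w ^ 3 ≤ u ^ 3 := pow_le_pow_left₀ hw0 hwu 3
  set B := 1 + u + (1 - c) * u ^ 2 / 2 with hB
  have hB1 : 1 ≤ B := by
    have : 0 ≤ (1 - c) * u ^ 2 := mul_nonneg (by linarith) (sq_nonneg u)
    rw [hB]; linarith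
  have h5 : Real.exp w ≤ B + u ^ 3 := by rw [hB]; linarith
  -- Since `B ≥ 1`, the additive cubic error can be turned into a factor.
  have h7 : B + u ^ 3 ≤ B * Real.exp (2 * u ^ 3) := by
    have := Real.add_one_le_exp (2 * u ^ 3)
    nlinarith
  have h8 : Real.exp (w - 2 * u ^ 3) ≤ B := by
    rw [Real.exp_sub, div_le_iff₀ (Real.exp_pos _)]
    linarith
  refine h8.trans ?_
  rw [hB, ← h6]
  linarith

section PoissonProduct

variable {ι : Type*} [Fintype ι] {ν : ι → ℝ} {v x b : ℝ}

theorem sum_pow_three_le (hb : ∀ j, x * ν j ≤ b) :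
    ∑ j, (x * ν j) ^ 3 ≤ b * (x ^ 2 * ∑ j, ν j ^ 2) := by
  rw [Finset.mul_sum, Finset.mul_sum]
  refine Finset.sum_le_sum fun j _ => ?_
  calc (x * ν j) ^ 3 = x * ν j * (x * ν j) ^ 2 := by ring
    _ ≤ b * (x * ν j) ^ 2 := mul_le_mul_of_nonneg_right (hb j) (sq_nonneg _)
    _ = _ := by ring

/-- The linear terms sum to `x` and cancel `exp (-x)`; the quadratic terms are the main
contribution, and the cubic ones are at most `b` times their sum of squares. -/
theorem exp_neg_mul_prod_le (h0 : ∀ j, 0 ≤ ν j) (h1 : ∑ j, ν j = 1) (hv0 : 0 ≤ v) (hv1 : v ≤ 1)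
    (hx : 0 ≤ x) (hb : ∀ j, x * ν j ≤ b) (hb1 : b ≤ 1) :
    Real.exp (-x) * ∏ j, (Real.exp (v * (x * ν j)) + (1 - v) * (x * ν j)) ≤
      Real.exp (x ^ 2 * (∑ j, ν j ^ 2) * (-(1 - v ^ 2) / 2 + 2 * b)) := by
  have h2 : ∏ j, (Real.exp (v * (x * ν j)) + (1 - v) * (x * ν j)) ≤
      ∏ j, Real.exp (x * ν j - (1 - v ^ 2) / 2 * (x * ν j) ^ 2 + 2 * (x * ν j) ^ 3) := by
    refine Finset.prod_le_prod (fun j _ => ?_) fun j _ =>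
      exp_add_le_exp hv0 hv1 (mul_nonneg hx (h0 j)) ((hb j).trans hb1)
    have := mul_nonneg (sub_nonneg.2 hv1) (mul_nonneg hx (h0 j))
    positivity
  refine (mul_le_mul_of_nonneg_left h2 (Real.exp_pos _).le).trans ?_
  rw [← Real.exp_sum, ← Real.exp_add, Real.exp_le_exp, Finset.sum_add_distrib,
    Finset.sum_sub_distrib, ← Finset.mul_sum, ← Finset.mul_sum, ← Finset.mul_sum, h1]
  have h3 := sum_pow_three_le hb
  have h4 : ∑ j, (x * ν j) ^ 2 = x ^ 2 * ∑ j, ν j ^ 2 := by simp only [mul_pow, Finset.mul_sum]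
  rw [h4]
  linarith

theorem le_exp_neg_mul_prod (h0 : ∀ j, 0 ≤ ν j) (h1 : ∑ j, ν j = 1) (hv0 : 0 ≤ v) (hv1 : v ≤ 1)
    (hx : 0 ≤ x) (hb : ∀ j, x * ν j ≤ b) (hb1 : b ≤ 1) :
    Real.exp (x ^ 2 * (∑ j, ν j ^ 2) * (-(1 - v ^ 2) / 2 - 2 * b)) ≤
      Real.exp (-x) * ∏ j, (Real.exp (v * (x * ν j)) + (1 - v) * (x * ν j)) := by
  have h2 : ∏ j, Real.exp (x * ν j - (1 - v ^ 2) / 2 * (x * ν j) ^ 2 - 2 * (x * ν j) ^ 3) ≤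
      ∏ j, (Real.exp (v * (x * ν j)) + (1 - v) * (x * ν j)) :=
    Finset.prod_le_prod (fun j _ => (Real.exp_pos _).le) fun j _ =>
      exp_le_exp_add hv0 hv1 (mul_nonneg hx (h0 j)) ((hb j).trans hb1)
  refine le_trans ?_ (mul_le_mul_of_nonneg_left h2 (Real.exp_pos _).le)
  rw [← Real.exp_sum, ← Real.exp_add, Real.exp_le_exp, Finset.sum_sub_distrib,
    Finset.sum_sub_distrib, ← Finset.mul_sum, ← Finset.mul_sum, ← Finset.mul_sum, h1]
  have h3 := sum_pow_three_le hb
  have h4 : ∑ j, (x * ν j) ^ 2 = x ^ 2 * ∑ j, ν j ^ 2 := by simp only [mul_pow, Finset.mul_sum]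
  rw [h4]
  linarith

end PoissonProduct

theorem laplace_mul_le {m : ℕ} {ν : Fin m → ℝ} (hν : ν ∈ stdSimplex ℝ (Fin m)) {θ x b : ℝ}
    (hθ : 0 ≤ θ) (hx : 0 ≤ x) (hb : ∀ j, x * ν j ≤ b) (hb1 : b ≤ 1) {n : ℕ} (hn : 0 < n) :
    laplace ν θ n * (1 - x / n) ≤
      Real.exp (x ^ 2 * (∑ j, ν j ^ 2) * (-(1 - Real.exp (-2 * θ)) / 2 + 2 * b)) := by
  have h := exp_neg_mul_prod_le hν.1 hν.2 (Real.exp_pos (-θ)).le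
    (Real.exp_le_one_iff.2 (neg_nonpos.2 hθ)) hx hb hb1
  have e : Real.exp (-2 * θ) = Real.exp (-θ) ^ 2 := by rw [← Real.exp_nat_mul]; ring_nf
  rw [e]
  exact (mul_one_sub_le_of_antitone (laplace_antitone hν hθ) (laplace_nonneg hν.1 θ) hx
    (hasSum_laplace ν θ x) hn).trans h

theorem exp_le_laplace_add {m : ℕ} {ν : Fin m → ℝ} (hν : ν ∈ stdSimplex ℝ (Fin m)) {θ x b s : ℝ}
    (hθ : 0 ≤ θ) (hx : 0 ≤ x) (hb : ∀ j, x * ν j ≤ b) (hb1 : b ≤ 1) (hs0 : 0 < s) (hs1 : s ≤ 1)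
    (n : ℕ) :
    Real.exp (x ^ 2 * (∑ j, ν j ^ 2) * (-(1 - Real.exp (-2 * θ)) / 2 - 2 * b)) ≤
      laplace ν θ n + s⁻¹ ^ n * Real.exp (x * (s - 1)) := by
  have h := le_exp_neg_mul_prod hν.1 hν.2 (Real.exp_pos (-θ)).le
    (Real.exp_le_one_iff.2 (neg_nonpos.2 hθ)) hx hb hb1
  have e : Real.exp (-2 * θ) = Real.exp (-θ) ^ 2 := by rw [← Real.exp_nat_mul]; ring_nf
  rw [e]
  exact h.trans (le_add_of_antitone (laplace_antitone hν hθ) (laplace_le_one hν hθ)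
    (laplace_nonneg hν.1 θ) hx hs0 hs1 (hasSum_laplace ν θ x) n)

/-! ### The mean of the statistic under the uniform law. -/

theorem expect_count_eq_zero {m : ℕ} {ν : Fin m → ℝ} (hν : ∑ j, ν j = 1) (n : ℕ) (j : Fin m) :
    (expect ν n fun z => if count z j = 0 then (1 : ℝ) else 0) = (1 - ν j) ^ n := by
  induction n with
  | zero => simp [expect_zero, count_elim0]
  | succ n ih =>
    have h : ∀ a, (expect ν n fun z =>
        if count (Fin.cons a z : Fin (n + 1) → Fin m) j = 0 then (1 : ℝ) else 0) =
        if a = j then 0 else (1 - ν j) ^ n := by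
      intro a
      simp only [count_cons]
      by_cases ha : a = j
      · simp [ha, expect_const hν]
      · simp [ha, ih]
    rw [expect_succ]
    simp only [h]
    have h2 : ∀ a, ν a * (if a = j then 0 else (1 - ν j) ^ n) =
        ν a * (1 - ν j) ^ n - if a = j then ν a * (1 - ν j) ^ n else 0 := fun a => by
      split_ifs <;> simp
    simp only [h2, Finset.sum_sub_distrib, ← Finset.sum_mul, hν]
    simp
    ring

theorem expect_count_eq_one {m : ℕ} {ν : Fin m → ℝ} (hν : ∑ j, ν j = 1) (n : ℕ) (j : Fin m) :
    (expect ν n fun z => if count z j = 1 then (1 : ℝ) else 0) =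
      n * ν j * (1 - ν j) ^ (n - 1) := by
  induction n with
  | zero => simp [expect_zero, count_elim0]
  | succ n ih =>
    have h : ∀ a, (expect ν n fun z =>
        if count (Fin.cons a z : Fin (n + 1) → Fin m) j = 1 then (1 : ℝ) else 0) =
        if a = j then (1 - ν j) ^ n else n * ν j * (1 - ν j) ^ (n - 1) := by
      intro a
      simp only [count_cons]
      by_cases ha : a = j
      · simp [ha, expect_count_eq_zero hν]
      · simp [ha, ih]
    rw [expect_succ]
    simp only [h]
    have h2 : ∀ a, ν a * (if a = j then (1 - ν j) ^ n else n * ν j * (1 - ν j) ^ (n - 1)) =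
        ν a * (n * ν j * (1 - ν j) ^ (n - 1)) +
          if a = j then ν a * ((1 - ν j) ^ n - n * ν j * (1 - ν j) ^ (n - 1)) else 0 := fun a => by
      split_ifs <;> ring
    simp only [h2, Finset.sum_add_distrib, ← Finset.sum_mul, hν]
    simp only [Finset.sum_ite_eq', Finset.mem_univ, if_true]
    -- The truncated `n - 1` is harmless at `n = 0`, where the factor `n` vanishes.
    rcases n with _ | n
    · simp
    · simp only [Nat.add_sub_cancel]
      push_cast
      ring

theorem expect_statistic_unif {m : ℕ} (hm : 0 < m) (n : ℕ) :
    expect (unif m) n statistic = -(n * (1 - 1 / (m : ℝ)) ^ (n - 1)) := by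
  have hm' : (m : ℝ) ≠ 0 := by positivity
  have h1 : ∑ j, unif m j = 1 := by simp [unif, hm']
  have h2 : expect (unif m) n statistic = (-1) * expect (unif m) n fun z =>
      ∑ j : Fin m, if count z j = 1 then (1 : ℝ) else 0 := by
    rw [← expect_const_mul]
    congr 1
    ext z
    rw [statistic, neg_one_mul]
  rw [h2, expect_sum]
  simp only [expect_count_eq_one h1]
  simp [unif]
  field_simp

/-! ### Asymptotics of the transform and of the mean excess. -/

/-- The speed `n² / m` of the large deviations. -/
noncomputable def speed (m : ℕ → ℕ) (n : ℕ) : ℝ := (n : ℝ) ^ 2 / (m n : ℝ)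

/-- The second moment of the likelihood ratio. -/
noncomputable def kappaAt (m : ℕ → ℕ) (q : (n : ℕ) → Fin (m n) → ℝ) (n : ℕ) : ℝ :=
  ∑ j : Fin (m n), (q n j) ^ 2 / unif (m n) j

theorem kappaAt_eq (m : ℕ → ℕ) (q : (n : ℕ) → Fin (m n) → ℝ) (n : ℕ) :
    kappaAt m q n = m n * ∑ j, q n j ^ 2 := by
  simp [kappaAt, unif, Finset.mul_sum, mul_comm]

theorem card_pos_of_mem {γ : ℝ} {m : ℕ} {q : Fin m → ℝ} (hq : q ∈ boundedPmf γ m) : 0 < m := by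
  rcases Nat.eq_zero_or_pos m with rfl | h
  · have := hq.1.2
    simp at this
  · exact h

theorem bound_nonneg_of_mem {γ : ℝ} {m : ℕ} {q : Fin m → ℝ} (hq : q ∈ boundedPmf γ m) :
    0 ≤ γ := by
  have hm := card_pos_of_mem hq
  have h := (hq.1.1 ⟨0, hm⟩).trans (hq.2 ⟨0, hm⟩)
  rw [le_div_iff₀ (by exact_mod_cast hm)] at h
  simpa using h

theorem kappaAt_nonneg (m : ℕ → ℕ) (q : (n : ℕ) → Fin (m n) → ℝ) (n : ℕ) : 0 ≤ kappaAt m q n := by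
  rw [kappaAt_eq]
  positivity

theorem kappaAt_le {m : ℕ → ℕ} {q : (n : ℕ) → Fin (m n) → ℝ} {γ : ℝ} {n : ℕ}
    (hq : q n ∈ boundedPmf γ (m n)) : kappaAt m q n ≤ γ := by
  have hm : (0 : ℝ) < m n := by exact_mod_cast card_pos_of_mem hq
  rw [kappaAt_eq, Finset.mul_sum]
  calc ∑ j, (m n : ℝ) * q n j ^ 2 ≤ ∑ j, γ * q n j := by
        refine Finset.sum_le_sum fun j _ => ?_
        have h := hq.2 j
        rw [le_div_iff₀ hm] at h
        nlinarith [hq.1.1 j]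
    _ = γ := by rw [← Finset.mul_sum, hq.1.2, mul_one]

section

variable {m : ℕ → ℕ} {q : (n : ℕ) → Fin (m n) → ℝ} {γ : ℝ}

theorem eventually_mem (hq : ∀ n : ℕ, 1 ≤ n → q n ∈ boundedPmf γ (m n)) :
    ∀ᶠ n in atTop, 0 < n ∧ q n ∈ boundedPmf γ (m n) := by
  filter_upwards [eventually_ge_atTop 1] with n hn
  exact ⟨hn, hq n hn⟩

theorem tendsto_density (hm : (fun n : ℕ => (n : ℝ)) =o[atTop] (fun n : ℕ => (m n : ℝ))) :
    Tendsto (fun n : ℕ => (n : ℝ) / m n) atTop (𝓝 0) := hm.tendsto_div_nhds_zero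

theorem tendsto_speed
    (hm : (fun n : ℕ => (m n : ℝ)) =o[atTop] (fun n : ℕ => (n : ℝ) ^ 2))
    (hq : ∀ n : ℕ, 1 ≤ n → q n ∈ boundedPmf γ (m n)) : Tendsto (speed m) atTop atTop := by
  have h : Tendsto (fun n : ℕ => (m n : ℝ) / (n : ℝ) ^ 2) atTop (𝓝[>] 0) := by
    rw [tendsto_nhdsWithin_iff]
    refine ⟨hm.tendsto_div_nhds_zero, ?_⟩
    filter_upwards [eventually_mem hq] with n hn
    have h1 : (0 : ℝ) < m n := by exact_mod_cast card_pos_of_mem hn.2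
    have h2 : (0 : ℝ) < n := by exact_mod_cast hn.1
    exact div_pos h1 (pow_pos h2 2)
  refine (h.inv_tendsto_nhdsGT_zero).congr fun n => ?_
  simp [speed]

/-- The Poisson mean is `n (1 - δ)`. Depoissonization costs the fixed factor `δ⁻¹`, negligible since
the speed tends to infinity; the cubic error vanishes since `n = o(m)`. -/
theorem eventually_laplace_le
    (hm_large : (fun n : ℕ => (n : ℝ)) =o[atTop] (fun n : ℕ => (m n : ℝ)))
    (hm_small : (fun n : ℕ => (m n : ℝ)) =o[atTop] (fun n : ℕ => (n : ℝ) ^ 2))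
    (hq : ∀ n : ℕ, 1 ≤ n → q n ∈ boundedPmf γ (m n)) {θ ε : ℝ} (hθ : 0 ≤ θ) (hε : 0 < ε) :
    ∀ᶠ n in atTop, laplace (q n) θ n ≤
      Real.exp (speed m n * (-(kappaAt m q n * (1 - Real.exp (-2 * θ)) / 2) + ε)) := by
  have hγ : 0 ≤ γ := bound_nonneg_of_mem (hq 1 le_rfl)
  obtain ⟨δ, hδ0, hδ1, hδ⟩ : ∃ δ : ℝ, 0 < δ ∧ δ ≤ 1 ∧ γ * δ ≤ ε / 4 := by
    refine ⟨min 1 (ε / (4 * (γ + 1))), by positivity, min_le_left _ _, ?_⟩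
    refine (mul_le_mul_of_nonneg_left (min_le_right _ _) hγ).trans ?_
    rw [mul_div_assoc', div_le_iff₀ (by positivity)]
    nlinarith
  have hb : Tendsto (fun n : ℕ => γ * ((n : ℝ) / m n)) atTop (𝓝 0) := by
    simpa using (tendsto_density hm_large).const_mul γ
  have hb2 : Tendsto (fun n : ℕ => 2 * γ * (γ * ((n : ℝ) / m n))) atTop (𝓝 0) := by
    simpa using hb.const_mul (2 * γ)
  filter_upwards [eventually_mem hq, hb.eventually_le_const one_pos,
    hb2.eventually_le_const (show 0 < ε / 4 by positivity),
    (tendsto_speed hm_small hq).eventually_ge_atTop (Real.log δ⁻¹ / (ε / 4)),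
    (tendsto_speed hm_small hq).eventually_ge_atTop 0] with n ⟨hn, hqn⟩ h1 h2 h3 hr
  have hm : (0 : ℝ) < m n := by exact_mod_cast card_pos_of_mem hqn
  have hn' : (0 : ℝ) < n := by exact_mod_cast hn
  have hρ : (0 : ℝ) ≤ n / m n := by positivity
  set b := γ * ((n : ℝ) / m n) with hbdef
  have hb0 : 0 ≤ b := by positivity
  have key := laplace_mul_le hqn.1 hθ (x := n * (1 - δ)) (b := b)
    (mul_nonneg hn'.le (by linarith)) (fun j => ?_) h1 hn
  · have e1 : 1 - n * (1 - δ) / (n : ℝ) = δ := by field_simp; ring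
    have e2 : (n * (1 - δ)) ^ 2 * ∑ j, q n j ^ 2 = (1 - δ) ^ 2 * (speed m n * kappaAt m q n) := by
      rw [kappaAt_eq, speed]; field_simp
    rw [e1, e2] at key
    have hκ0 := kappaAt_nonneg m q n
    have hκ1 := kappaAt_le hqn
    set κ := kappaAt m q n
    set r := speed m n
    have hc0 : 0 ≤ 1 - Real.exp (-2 * θ) := by
      have : Real.exp (-2 * θ) ≤ 1 := Real.exp_le_one_iff.2 (by linarith)
      linarith
    have hc1 : 1 - Real.exp (-2 * θ) ≤ 1 := by linarith [Real.exp_pos (-2 * θ)]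
    set c := 1 - Real.exp (-2 * θ)
    rw [div_le_iff₀ (by positivity)] at h3
    have h4 : δ⁻¹ ≤ Real.exp (r * (ε / 4)) := by
      rw [← Real.log_le_iff_le_exp (by positivity)]; exact h3
    have h5 : (1 - δ) ^ 2 * (r * κ) * (-c / 2 + 2 * b) ≤ r * (-(κ * c / 2) + ε / 2) := by
      have h6 : (1 - δ) ^ 2 * κ * (-c / 2 + 2 * b) ≤ -(κ * c / 2) + ε / 2 := by
        have hs : (1 - δ) ^ 2 ≤ 1 := by nlinarith
        have hs2 : 1 - (1 - δ) ^ 2 ≤ 2 * δ := by nlinarith [sq_nonneg δ]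
        have hκc : κ * c ≤ γ := (mul_le_of_le_one_right hκ0 hc1).trans hκ1
        have g1 : (1 - (1 - δ) ^ 2) * (κ * c) ≤ 2 * δ * γ :=
          mul_le_mul hs2 hκc (mul_nonneg hκ0 hc0) (by linarith)
        have g2 : (1 - δ) ^ 2 * (κ * b) ≤ γ * b :=
          (mul_le_of_le_one_left (mul_nonneg hκ0 hb0) hs).trans
            (mul_le_mul_of_nonneg_right hκ1 hb0)
        nlinarith
      calc _ = r * ((1 - δ) ^ 2 * κ * (-c / 2 + 2 * b)) := by ring
        _ ≤ _ := mul_le_mul_of_nonneg_left h6 hr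
    calc laplace (q n) θ n = laplace (q n) θ n * δ * δ⁻¹ := by field_simp
      _ ≤ Real.exp (r * (-(κ * c / 2) + ε / 2)) * Real.exp (r * (ε / 4)) :=
          mul_le_mul (key.trans (Real.exp_le_exp.2 h5)) h4 (by positivity) (Real.exp_pos _).le
      _ ≤ _ := by
          rw [← Real.exp_add, Real.exp_le_exp]
          nlinarith
  · have := hqn.2 j
    calc n * (1 - δ) * q n j ≤ n * (γ / m n) := by
          refine mul_le_mul ?_ this (hqn.1.1 j) hn'.le
          nlinarith
      _ = b := by rw [hbdef]; ring

/-- The Poisson mean is `n (1 + δ)`, and `s = (1 + δ)⁻¹` optimizes the Chernoff bound. The tail `exp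
(-n d)`, with `d = δ - log (1 + δ) > 0`, is negligible because the speed `n · (n / m)` is `o(n)`. -/
theorem eventually_le_laplace
    (hm_large : (fun n : ℕ => (n : ℝ)) =o[atTop] (fun n : ℕ => (m n : ℝ)))
    (hm_small : (fun n : ℕ => (m n : ℝ)) =o[atTop] (fun n : ℕ => (n : ℝ) ^ 2))
    (hq : ∀ n : ℕ, 1 ≤ n → q n ∈ boundedPmf γ (m n)) {θ ε : ℝ} (hθ : 0 ≤ θ) (hε : 0 < ε) :
    ∀ᶠ n in atTop,
      Real.exp (speed m n * (-(kappaAt m q n * (1 - Real.exp (-2 * θ)) / 2) - ε)) ≤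
        laplace (q n) θ n := by
  have hγ : 0 ≤ γ := bound_nonneg_of_mem (hq 1 le_rfl)
  obtain ⟨δ, hδ0, hδ1, hδ⟩ : ∃ δ : ℝ, 0 < δ ∧ δ ≤ 1 ∧ γ * δ ≤ ε / 8 := by
    refine ⟨min 1 (ε / (8 * (γ + 1))), by positivity, min_le_left _ _, ?_⟩
    refine (mul_le_mul_of_nonneg_left (min_le_right _ _) hγ).trans ?_
    rw [mul_div_assoc', div_le_iff₀ (by positivity)]
    nlinarith
  have hδlog : 0 < δ - Real.log (1 + δ) := by
    have := Real.log_lt_sub_one_of_pos (show 0 < 1 + δ by linarith) (by linarith)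
    linarith
  set d := δ - Real.log (1 + δ) with hd
  have hb : Tendsto (fun n : ℕ => 2 * γ * ((n : ℝ) / m n)) atTop (𝓝 0) := by
    simpa using (tendsto_density hm_large).const_mul (2 * γ)
  have hb2 : Tendsto (fun n : ℕ => 8 * γ * (2 * γ * ((n : ℝ) / m n))) atTop (𝓝 0) := by
    simpa using hb.const_mul (8 * γ)
  have hb3 : Tendsto (fun n : ℕ => (γ + ε) * ((n : ℝ) / m n)) atTop (𝓝 0) := by
    simpa using (tendsto_density hm_large).const_mul (γ + ε)
  filter_upwards [eventually_mem hq, hb.eventually_le_const one_pos,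
    hb2.eventually_le_const (show 0 < ε / 4 by positivity),
    hb3.eventually_le_const (show 0 < d / 2 by positivity),
    (tendsto_speed hm_small hq).eventually_ge_atTop (Real.log 2 / (ε / 2)),
    tendsto_natCast_atTop_atTop.eventually_ge_atTop (Real.log 2 / (d / 2)),
    (tendsto_speed hm_small hq).eventually_ge_atTop 0] with n ⟨hn, hqn⟩ h1 h2 h2' h3 h3' hr
  have hm : (0 : ℝ) < m n := by exact_mod_cast card_pos_of_mem hqn
  have hn' : (0 : ℝ) < n := by exact_mod_cast hn
  have hρ : (0 : ℝ) ≤ n / m n := by positivity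
  set b := 2 * γ * ((n : ℝ) / m n) with hbdef
  have hb0 : 0 ≤ b := by positivity
  have key := exp_le_laplace_add hqn.1 hθ (x := n * (1 + δ)) (b := b) (s := (1 + δ)⁻¹)
    (by positivity) (fun j => ?_) h1 (by positivity) (inv_le_one_of_one_le₀ (by linarith)) n
  · have e1 : (1 + δ)⁻¹⁻¹ ^ n * Real.exp (n * (1 + δ) * ((1 + δ)⁻¹ - 1)) = Real.exp (-(n * d)) := by
      have g : (1 + δ)⁻¹⁻¹ ^ n = Real.exp (n * Real.log (1 + δ)) := by
        rw [Real.exp_nat_mul, Real.exp_log (by linarith), inv_inv]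
      rw [g, ← Real.exp_add, hd]
      congr 1
      field_simp
      ring
    have e2 : (n * (1 + δ)) ^ 2 * ∑ j, q n j ^ 2 = (1 + δ) ^ 2 * (speed m n * kappaAt m q n) := by
      rw [kappaAt_eq, speed]; field_simp
    have e3 : speed m n = n * (n / m n) := by rw [speed]; ring
    rw [e1, e2] at key
    have hκ0 := kappaAt_nonneg m q n
    have hκ1 := kappaAt_le hqn
    set κ := kappaAt m q n
    set r := speed m n
    have hc0 : 0 ≤ 1 - Real.exp (-2 * θ) := by
      have : Real.exp (-2 * θ) ≤ 1 := Real.exp_le_one_iff.2 (by linarith)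
      linarith
    have hc1 : 1 - Real.exp (-2 * θ) ≤ 1 := by linarith [Real.exp_pos (-2 * θ)]
    set c := 1 - Real.exp (-2 * θ)
    have hκc : κ * c ≤ γ := (mul_le_of_le_one_right hκ0 hc1).trans hκ1
    rw [div_le_iff₀ (by positivity)] at h3 h3'
    have h5 : r * (-(κ * c / 2) - ε / 2) ≤ (1 + δ) ^ 2 * (r * κ) * (-c / 2 - 2 * b) := by
      have h6 : -(κ * c / 2) - ε / 2 ≤ (1 + δ) ^ 2 * κ * (-c / 2 - 2 * b) := by
        have hs : (1 + δ) ^ 2 ≤ 4 := by nlinarith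
        have hs2 : (1 + δ) ^ 2 - 1 ≤ 3 * δ := by nlinarith
        have g1 : ((1 + δ) ^ 2 - 1) * (κ * c) ≤ 3 * δ * γ :=
          mul_le_mul hs2 hκc (mul_nonneg hκ0 hc0) (by linarith)
        have g2 : (1 + δ) ^ 2 * (κ * b) ≤ 4 * (γ * b) :=
          mul_le_mul hs (mul_le_mul_of_nonneg_right hκ1 hb0) (mul_nonneg hκ0 hb0) (by norm_num)
        nlinarith
      calc _ ≤ r * ((1 + δ) ^ 2 * κ * (-c / 2 - 2 * b)) := mul_le_mul_of_nonneg_left h6 hr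
        _ = _ := by ring
    have h7 := (Real.exp_le_exp.2 h5).trans key
    have h8 : 2 * Real.exp (-(n * d)) ≤ Real.exp (r * (-(κ * c / 2) - ε / 2)) := by
      nth_rewrite 1 [← Real.exp_log (show (0 : ℝ) < 2 by norm_num)]
      rw [← Real.exp_add, Real.exp_le_exp]
      have g1 : r * (γ + ε) ≤ n * (d / 2) := by
        rw [e3]
        calc _ = n * ((γ + ε) * (n / m n)) := by ring
          _ ≤ _ := mul_le_mul_of_nonneg_left h2' hn'.le
      have g2 : r * (κ * c / 2 + ε / 2) ≤ r * (γ + ε) :=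
        mul_le_mul_of_nonneg_left (by linarith) hr
      linarith
    have h9 : 2 * Real.exp (r * (-(κ * c / 2) - ε)) ≤ Real.exp (r * (-(κ * c / 2) - ε / 2)) := by
      nth_rewrite 1 [← Real.exp_log (show (0 : ℝ) < 2 by norm_num)]
      rw [← Real.exp_add, Real.exp_le_exp]
      linarith
    linarith
  · have := hqn.2 j
    calc n * (1 + δ) * q n j ≤ n * 2 * (γ / m n) := by
          refine mul_le_mul ?_ this (hqn.1.1 j) (by positivity)
          nlinarith
      _ = b := by rw [hbdef]; ring

theorem tendsto_excess_mean
    (hm_large : (fun n : ℕ => (n : ℝ)) =o[atTop] (fun n : ℕ => (m n : ℝ)))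
    (hq : ∀ n : ℕ, 1 ≤ n → q n ∈ boundedPmf γ (m n)) :
    Tendsto (fun n : ℕ => (n + expect (unif (m n)) n statistic) / speed m n) atTop (𝓝 1) := by
  have hlow : Tendsto (fun n : ℕ => 1 - 1 / (n : ℝ) - (n : ℝ) / m n) atTop (𝓝 1) := by
    simpa using (tendsto_const_nhds (x := (1 : ℝ))).sub tendsto_one_div_atTop_nhds_zero_nat
      |>.sub (tendsto_density hm_large)
  refine tendsto_of_tendsto_of_tendsto_of_le_of_le' hlow tendsto_const_nhds ?_ ?_
  all_goals
    filter_upwards [eventually_mem hq] with n ⟨hn, hqn⟩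
    have hm0 := card_pos_of_mem hqn
    have hm : (1 : ℝ) ≤ m n := by exact_mod_cast hm0
    have hn' : (1 : ℝ) ≤ n := by exact_mod_cast hn
    obtain ⟨k, rfl⟩ : ∃ k, n = k + 1 := ⟨n - 1, by omega⟩
    rw [expect_statistic_unif hm0, speed, Nat.add_sub_cancel]
    set M := (m (k + 1) : ℝ)
    have hM : 1 / M ≤ 1 := by rw [div_le_one (by linarith)]; exact hm
    have hM0 : 0 ≤ 1 / M := by positivity
    push_cast at *
  · have h := one_add_mul_le_pow (show (-2 : ℝ) ≤ -(1 / M) by linarith) k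
    have h' : 1 - k * (1 / M) ≤ (1 - 1 / M) ^ k := by
      rw [sub_eq_add_neg 1 (1 / M)]; linarith
    have h2 := one_add_mul_le_pow (show (-2 : ℝ) ≤ 1 / M by linarith) k
    have hP0 : 0 ≤ (1 - 1 / M) ^ k := pow_nonneg (by linarith) k
    -- From `(1 - y)(1 + y) ≤ 1` and Bernoulli. With `P ≥ 1 - k y` it yields `1 - P ≥ P k y ≥ k y -
    -- (k y)²`.
    have h3 : (1 - 1 / M) ^ k * (1 + k * (1 / M)) ≤ 1 := by
      refine (mul_le_mul_of_nonneg_left h2 hP0).trans ?_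
      rw [← mul_pow]
      exact pow_le_one₀ (by nlinarith) (by nlinarith)
    set P := (1 - 1 / M) ^ k
    set y := 1 / M with hy
    have hMy : M * y = 1 := by rw [hy]; field_simp
    have hky : 0 ≤ k * y := by positivity
    have e1 : 1 - 1 / ((k : ℝ) + 1) - (k + 1) / M = (k - (k + 1) ^ 2 * y) / (k + 1) := by
      rw [hy]; field_simp; ring
    have e2 : ((k : ℝ) + 1 + -((k + 1) * P)) / ((k + 1) ^ 2 / M) = (1 - P) * M / (k + 1) := by
      field_simp; ring
    rw [e1, e2]
    refine div_le_div_of_nonneg_right ?_ (by positivity)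
    have h4 : k * y - (k * y) ^ 2 ≤ 1 - P := by nlinarith
    calc (k : ℝ) - (k + 1) ^ 2 * y ≤ k - k ^ 2 * y := by
          nlinarith [mul_nonneg (Nat.cast_nonneg (α := ℝ) k) hM0]
      _ = (k * y - (k * y) ^ 2) * M := by linear_combination (-(k : ℝ) + k ^ 2 * y) * hMy
      _ ≤ _ := mul_le_mul_of_nonneg_right h4 (by linarith)
  · have h := one_add_mul_le_pow (show (-2 : ℝ) ≤ -(1 / M) by linarith) k
    rw [div_le_one (by positivity), le_div_iff₀ (by positivity)]
    have h' : 1 - k / M ≤ (1 - 1 / M) ^ k := by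
      rw [div_eq_mul_one_div, sub_eq_add_neg 1 (1 / M)]; linarith
    have h3 : (1 - (1 - 1 / M) ^ k) * M ≤ k := by
      calc _ ≤ (k / M) * M := mul_le_mul_of_nonneg_right (by linarith) (by linarith)
        _ = k := by field_simp
    nlinarith

end

/-! ### Chernoff bound and exponential tilting. -/

theorem missEvent_eq (n m : ℕ) (τ : ℝ) :
    missEvent n m τ = {z : Fin n → Fin m |
      excess z ≤ n + expect (unif m) n statistic + (n : ℝ) ^ 2 / (m : ℝ) * τ} := by
  ext z
  simp only [missEvent, excess, Set.mem_ofPred_eq]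
  constructor <;> intro h <;> linarith

theorem prob_mono {m : ℕ} {ν : Fin m → ℝ} (hν : ∀ j, 0 ≤ ν j) {n : ℕ}
    {A B : Set (Fin n → Fin m)} (h : A ⊆ B) : prob ν n A ≤ prob ν n B := by
  classical
  refine expect_mono hν fun z => ?_
  by_cases hz : z ∈ A
  · simp [hz, h hz]
  · simp only [hz, if_false]
    split_ifs <;> norm_num

theorem prob_excess_le {m : ℕ} {ν : Fin m → ℝ} (hν : ∀ j, 0 ≤ ν j) {n : ℕ} {θ : ℝ} (hθ : 0 ≤ θ)
    (y : ℝ) : prob ν n {z | excess z ≤ y} ≤ Real.exp (θ * y) * laplace ν θ n := by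
  classical
  rw [laplace, ← expect_const_mul]
  refine expect_mono hν fun z => ?_
  rw [← Real.exp_add]
  split_ifs with h
  · rw [Real.one_le_exp_iff]
    nlinarith [show excess z ≤ y from h]
  · exact (Real.exp_pos _).le

/-- A change of measure in pointwise form: outside the window `[y₁, y₂]` the weight `exp (-θ *
excess)` is dominated using the neighbouring tilts `θ + s` (below) and `θ - s` (above). -/
theorem laplace_le_of_tilt {m : ℕ} {ν : Fin m → ℝ} (hν : ∀ j, 0 ≤ ν j) {n : ℕ} {θ s : ℝ}
    (hθ : 0 ≤ θ) (hs : 0 ≤ s) (y₁ y₂ : ℝ) :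
    laplace ν θ n ≤ Real.exp (-θ * y₁) * prob ν n {z | excess z ≤ y₂} +
      Real.exp (s * y₁) * laplace ν (θ + s) n + Real.exp (-s * y₂) * laplace ν (θ - s) n := by
  classical
  unfold prob laplace
  rw [← expect_const_mul, ← expect_const_mul, ← expect_const_mul, ← expect_add, ← expect_add]
  refine expect_mono hν fun z => ?_
  simp only [← Real.exp_add]
  have p1 := Real.exp_pos (s * y₁ + -(θ + s) * excess z)
  have p2 := Real.exp_pos (-s * y₂ + -(θ - s) * excess z)
  have p3 := Real.exp_pos (-θ * y₁)
  by_cases h2 : excess z ≤ y₂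
  · simp only [Set.mem_ofPred_eq, h2, if_true, mul_one]
    by_cases h1 : y₁ ≤ excess z
    · have : Real.exp (-θ * excess z) ≤ Real.exp (-θ * y₁) := Real.exp_le_exp.2 (by nlinarith)
      linarith
    · have : Real.exp (-θ * excess z) ≤ Real.exp (s * y₁ + -(θ + s) * excess z) :=
        Real.exp_le_exp.2 (by nlinarith)
      linarith
  · simp only [Set.mem_ofPred_eq, h2, if_false, mul_zero]
    have : Real.exp (-θ * excess z) ≤ Real.exp (-s * y₂ + -(θ - s) * excess z) :=
      Real.exp_le_exp.2 (by nlinarith)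
    linarith

theorem exp_le_one_add_add_sq {x : ℝ} (hx : |x| ≤ 1) : Real.exp x ≤ 1 + x + x ^ 2 := by
  have := (abs_le.1 (Real.abs_exp_sub_one_sub_id_le hx)).2
  linarith

section

variable {m : ℕ → ℕ} {q : (n : ℕ) → Fin (m n) → ℝ} {γ : ℝ}

/-- Under the tilt `θ` the excess concentrates near `r κ exp (-2θ)`, minus the derivative of the
limiting log-transform. The condition on `kappaAt` stays inside the filter because it need only hold
for infinitely many `n`. -/
theorem eventually_le_prob_excess
    (hm_large : (fun n : ℕ => (n : ℝ)) =o[atTop] (fun n : ℕ => (m n : ℝ)))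
    (hm_small : (fun n : ℕ => (m n : ℝ)) =o[atTop] (fun n : ℕ => (n : ℝ) ^ 2))
    (hq : ∀ n : ℕ, 1 ≤ n → q n ∈ boundedPmf γ (m n)) {κ θ δ : ℝ} (hκ : 0 ≤ κ) (hθ : 0 < θ)
    (hδ : 0 < δ) :
    ∃ η > 0, ∀ᶠ n in atTop, |kappaAt m q n - κ| ≤ η →
      Real.exp (speed m n * (θ * (κ * Real.exp (-2 * θ)) - κ * (1 - Real.exp (-2 * θ)) / 2
        - δ * (θ + 1))) ≤
      prob (q n) n {z | excess z ≤ speed m n * (κ * Real.exp (-2 * θ) + δ)} := by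
  -- Leaving the window gains `s δ` in the exponent; `s * (4 * κ) ≤ δ` keeps the second-order error
  -- below half of that, and `s ≤ θ` keeps `θ - s` admissible.
  obtain ⟨s, hs0, hsθ, hs1, hsδ⟩ : ∃ s : ℝ, 0 < s ∧ s ≤ θ ∧ s ≤ 1 / 2 ∧ s * (4 * κ) ≤ δ := by
    refine ⟨min θ (min (1 / 2) (δ / (4 * κ + 1))), by positivity, min_le_left _ _,
      (min_le_right _ _).trans (min_le_left _ _), ?_⟩
    have h : min θ (min (1 / 2) (δ / (4 * κ + 1))) ≤ δ / (4 * κ + 1) :=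
      (min_le_right _ _).trans (min_le_right _ _)
    rw [le_div_iff₀ (by positivity)] at h
    have : 0 < min θ (min (1 / 2) (δ / (4 * κ + 1))) := by positivity
    linarith
  have hsδ0 : 0 < s * δ := mul_pos hs0 hδ
  refine ⟨s * δ / 16, by positivity, ?_⟩
  have hε : 0 < s * δ / 16 := by positivity
  filter_upwards [eventually_mem hq, eventually_le_laplace hm_large hm_small hq hθ.le hε,
    eventually_laplace_le hm_large hm_small hq (show 0 ≤ θ + s by positivity) hε,
    eventually_laplace_le hm_large hm_small hq (sub_nonneg.2 hsθ) hε,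
    (tendsto_speed hm_small hq).eventually_ge_atTop (Real.log 2 / (s * δ / 8)),
    (tendsto_speed hm_small hq).eventually_ge_atTop 0] with n ⟨_, hqn⟩ h1 h2 h3 h4 hr hη
  rw [div_le_iff₀ (by positivity)] at h4
  obtain ⟨hη1, hη2⟩ := abs_le.1 hη
  set k := kappaAt m q n
  set r := speed m n
  have hE0 := Real.exp_pos (-2 * θ)
  have hE1 : Real.exp (-2 * θ) ≤ 1 := Real.exp_le_one_iff.2 (by linarith)
  have e2 : Real.exp (-2 * (θ + s)) = Real.exp (-2 * θ) * Real.exp (-2 * s) := by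
    rw [← Real.exp_add]; ring_nf
  have e3 : Real.exp (-2 * (θ - s)) = Real.exp (-2 * θ) * Real.exp (2 * s) := by
    rw [← Real.exp_add]; ring_nf
  have q2 : Real.exp (-2 * s) ≤ 1 + -2 * s + (-2 * s) ^ 2 :=
    exp_le_one_add_add_sq (abs_le.2 ⟨by linarith, by linarith⟩)
  have q3 : Real.exp (2 * s) ≤ 1 + 2 * s + (2 * s) ^ 2 :=
    exp_le_one_add_add_sq (abs_le.2 ⟨by linarith, by linarith⟩)
  have c2 : Real.exp (-2 * (θ + s)) ≤ 1 := Real.exp_le_one_iff.2 (by linarith)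
  have c3 : Real.exp (-2 * (θ - s)) ≤ 1 := Real.exp_le_one_iff.2 (by linarith)
  have p2 := Real.exp_pos (-2 * (θ + s))
  have p3 := Real.exp_pos (-2 * (θ - s))
  have tilt := laplace_le_of_tilt hqn.1.1 (n := n) hθ.le hs0.le
    (r * (κ * Real.exp (-2 * θ) - δ)) (r * (κ * Real.exp (-2 * θ) + δ))
  set p := prob (q n) n {z | excess z ≤ r * (κ * Real.exp (-2 * θ) + δ)}
  set E := Real.exp (-2 * θ)
  set E2 := Real.exp (-2 * (θ + s))
  set E3 := Real.exp (-2 * (θ - s))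
  have hκE : 0 ≤ κ * E := mul_nonneg hκ hE0.le
  have hκE1 : κ * E ≤ κ := mul_le_of_le_one_right hκ hE1
  have hquad : 2 * (κ * E) * s ^ 2 ≤ s * δ / 2 := by
    calc 2 * (κ * E) * s ^ 2 ≤ 2 * κ * s ^ 2 := by gcongr
      _ = s * (s * (4 * κ)) / 2 := by ring
      _ ≤ s * δ / 2 := by gcongr
  have hk : ∀ F : ℝ, 0 < F → F ≤ 1 → |(k - κ) * (1 - F)| ≤ s * δ / 16 := fun F hF0 hF1 => by
    rw [abs_mul, abs_of_nonneg (sub_nonneg.2 hF1)]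
    exact (mul_le_of_le_one_right (abs_nonneg _) (by linarith)).trans hη
  have b1 : Real.exp (r * (-(κ * (1 - E) / 2) - s * δ / 8)) ≤ laplace (q n) θ n := by
    refine (Real.exp_le_exp.2 (mul_le_mul_of_nonneg_left ?_ hr)).trans h1
    linarith [(abs_le.1 (hk E hE0 hE1)).2]
  have b2 : Real.exp (s * (r * (κ * E - δ))) * laplace (q n) (θ + s) n ≤
      Real.exp (r * (-(κ * (1 - E) / 2) - 3 * (s * δ) / 8)) := by
    refine (mul_le_mul_of_nonneg_left h2 (Real.exp_pos _).le).trans ?_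
    rw [← Real.exp_add, Real.exp_le_exp]
    have g1 : κ * E2 ≤ κ * E * (1 + -2 * s + (-2 * s) ^ 2) := by
      rw [e2, ← mul_assoc]; exact mul_le_mul_of_nonneg_left q2 hκE
    have g2 : s * (κ * E - δ) + (-(k * (1 - E2) / 2) + s * δ / 16) ≤
        -(κ * (1 - E) / 2) - 3 * (s * δ) / 8 := by
      linarith [(abs_le.1 (hk E2 p2 c2)).1]
    calc _ = r * (s * (κ * E - δ) + (-(k * (1 - E2) / 2) + s * δ / 16)) := by ring
      _ ≤ _ := mul_le_mul_of_nonneg_left g2 hr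
  have b3 : Real.exp (-s * (r * (κ * E + δ))) * laplace (q n) (θ - s) n ≤
      Real.exp (r * (-(κ * (1 - E) / 2) - 3 * (s * δ) / 8)) := by
    refine (mul_le_mul_of_nonneg_left h3 (Real.exp_pos _).le).trans ?_
    rw [← Real.exp_add, Real.exp_le_exp]
    have g1 : κ * E3 ≤ κ * E * (1 + 2 * s + (2 * s) ^ 2) := by
      rw [e3, ← mul_assoc]; exact mul_le_mul_of_nonneg_left q3 hκE
    have g2 : -s * (κ * E + δ) + (-(k * (1 - E3) / 2) + s * δ / 16) ≤
        -(κ * (1 - E) / 2) - 3 * (s * δ) / 8 := by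
      linarith [(abs_le.1 (hk E3 p3 c3)).1]
    calc _ = r * (-s * (κ * E + δ) + (-(k * (1 - E3) / 2) + s * δ / 16)) := by ring
      _ ≤ _ := mul_le_mul_of_nonneg_left g2 hr
  have two : ∀ a b : ℝ, Real.log 2 ≤ b - a → 2 * Real.exp a ≤ Real.exp b := fun a b h => by
    nth_rewrite 1 [← Real.exp_log (show (0 : ℝ) < 2 by norm_num)]
    rw [← Real.exp_add, Real.exp_le_exp]
    linarith
  -- The two outside terms together are at most half of the transform, so the window term carries
  -- the other half.
  have b4 := two (r * (-(κ * (1 - E) / 2) - 3 * (s * δ) / 8))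
    (r * (-(κ * (1 - E) / 2) - 2 * (s * δ) / 8)) (by linarith)
  have b5 := two (r * (-(κ * (1 - E) / 2) - 2 * (s * δ) / 8))
    (r * (-(κ * (1 - E) / 2) - s * δ / 8)) (by linarith)
  have b6 := two (r * (-(κ * (1 - E) / 2) - δ)) (r * (-(κ * (1 - E) / 2) - s * δ / 8)) (by
    have : r * (s * δ / 8) ≤ r * (δ - s * δ / 8) :=
      mul_le_mul_of_nonneg_left
        (by linarith [mul_le_mul_of_nonneg_right hs1 hδ.le]) hr
    linarith)
  have b7 : Real.exp (r * (-(κ * (1 - E) / 2) - δ)) ≤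
      Real.exp (-θ * (r * (κ * E - δ))) * p := by linarith
  have b8 := mul_le_mul_of_nonneg_left b7 (Real.exp_pos (θ * (r * (κ * E - δ)))).le
  rw [← mul_assoc (Real.exp _) (Real.exp _) p, ← Real.exp_add, ← Real.exp_add] at b8
  have e : θ * (r * (κ * E - δ)) + -θ * (r * (κ * E - δ)) = 0 := by ring
  rw [e, Real.exp_zero, one_mul] at b8
  refine le_trans (le_of_eq ?_) b8
  congr 1
  ring

end

/-! ### Bounds on the rate. -/

theorem log_ofReal_exp (y : ℝ) : ENNReal.log (ENNReal.ofReal (Real.exp y)) = y := by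
  rw [← EReal.exp_coe, EReal.log_exp]

theorem inv_mul_log_le {P r c : ℝ} (hr : 0 < r) (h : P ≤ Real.exp (r * c)) :
    ((r⁻¹ : ℝ) : EReal) * ENNReal.log (ENNReal.ofReal P) ≤ c := by
  have h1 : ENNReal.log (ENNReal.ofReal P) ≤ ((r * c : ℝ) : EReal) := by
    rw [← log_ofReal_exp]
    exact ENNReal.log_monotone (ENNReal.ofReal_le_ofReal h)
  refine (mul_le_mul_of_nonneg_left h1 (by exact_mod_cast (inv_pos.2 hr).le)).trans_eq ?_
  rw [← EReal.coe_mul]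
  congr 1
  field_simp

theorem le_inv_mul_log {P r c : ℝ} (hr : 0 < r) (h : Real.exp (r * c) ≤ P) :
    (c : EReal) ≤ ((r⁻¹ : ℝ) : EReal) * ENNReal.log (ENNReal.ofReal P) := by
  have h1 : ((r * c : ℝ) : EReal) ≤ ENNReal.log (ENNReal.ofReal P) := by
    rw [← log_ofReal_exp]
    exact ENNReal.log_monotone (ENNReal.ofReal_le_ofReal h)
  refine le_trans (le_of_eq ?_)
    (mul_le_mul_of_nonneg_left h1 (by exact_mod_cast (inv_pos.2 hr).le))
  rw [← EReal.coe_mul]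
  congr 1
  field_simp

theorem coe_le_of_forall_pos_sub_le {a C : ℝ} {b : EReal}
    (h : ∀ ε > 0, ((a - C * ε : ℝ) : EReal) ≤ b) : (a : EReal) ≤ b := by
  have hc : Continuous fun ε : ℝ => ((a - C * ε : ℝ) : EReal) :=
    continuous_coe_real_ereal.comp (by fun_prop)
  have h1 : Tendsto (fun ε : ℝ => ((a - C * ε : ℝ) : EReal)) (𝓝[>] 0) (𝓝 (a : EReal)) := by
    simpa using (hc.tendsto 0).mono_left nhdsWithin_le_nhds
  exact le_of_tendsto h1 (by filter_upwards [self_mem_nhdsWithin] with ε hε using h ε hε)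

section

variable {m : ℕ → ℕ} {q : (n : ℕ) → Fin (m n) → ℝ} {γ : ℝ}

theorem isBoundedUnder_kappaAt (hq : ∀ n : ℕ, 1 ≤ n → q n ∈ boundedPmf γ (m n)) :
    IsBoundedUnder (· ≤ ·) atTop (kappaAt m q) :=
  isBoundedUnder_of_eventually_le (a := γ) <| by
    filter_upwards [eventually_mem hq] with n hn using kappaAt_le hn.2

theorem isBoundedUnder_ge_kappaAt : IsBoundedUnder (· ≥ ·) atTop (kappaAt m q) :=
  isBoundedUnder_of_eventually_ge (a := 0) <| Eventually.of_forall (kappaAt_nonneg m q)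

theorem kappa_nonneg (hq : ∀ n : ℕ, 1 ≤ n → q n ∈ boundedPmf γ (m n)) : 0 ≤ kappa m q :=
  le_liminf_of_le (isBoundedUnder_kappaAt hq).isCoboundedUnder_ge
    (Eventually.of_forall (kappaAt_nonneg m q))

theorem rate_eq_neg_limsup (m : ℕ → ℕ) (q : (n : ℕ) → Fin (m n) → ℝ) (τ : ℝ) :
    rate m q τ = -limsup (fun n : ℕ => (((speed m n)⁻¹ : ℝ) : EReal) * ENNReal.log
      (ENNReal.ofReal (prob (q n) n {z | excess z ≤
        n + expect (unif (m n)) n statistic + speed m n * τ}))) atTop := by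
  simp only [rate, missEvent_eq, speed, inv_div]

theorem le_rate
    (hm_large : (fun n : ℕ => (n : ℝ)) =o[atTop] (fun n : ℕ => (m n : ℝ)))
    (hm_small : (fun n : ℕ => (m n : ℝ)) =o[atTop] (fun n : ℕ => (n : ℝ) ^ 2))
    (hq : ∀ n : ℕ, 1 ≤ n → q n ∈ boundedPmf γ (m n)) (τ : ℝ) {θ : ℝ} (hθ : 0 ≤ θ) :
    ((θ * (-1 - τ) - 1 / 2 * (Real.exp (-2 * θ) - 1) * kappa m q : ℝ) : EReal) ≤ rate m q τ := by
  refine coe_le_of_forall_pos_sub_le (C := θ + 2) fun ε hε => ?_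
  rw [rate_eq_neg_limsup, EReal.le_neg]
  rw [← EReal.coe_neg]
  refine limsup_le_of_le (h := ?_)
  filter_upwards [eventually_mem hq, eventually_laplace_le hm_large hm_small hq hθ hε,
    (tendsto_speed hm_small hq).eventually_gt_atTop 0,
    (tendsto_excess_mean hm_large hq).eventually_le_const (show 1 < 1 + ε by linarith),
    eventually_lt_of_lt_liminf (show kappa m q - ε < liminf (kappaAt m q) atTop from
      sub_lt_self _ hε) isBoundedUnder_ge_kappaAt] with n ⟨_, hqn⟩ h1 hr h2 h3
  refine inv_mul_log_le hr ((prob_excess_le hqn.1.1 hθ _).trans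
    ((mul_le_mul_of_nonneg_left h1 (Real.exp_pos _).le).trans ?_))
  rw [← Real.exp_add, Real.exp_le_exp]
  rw [div_le_iff₀ hr] at h2
  have hE0 := Real.exp_pos (-2 * θ)
  have hE1 : Real.exp (-2 * θ) ≤ 1 := Real.exp_le_one_iff.2 (by linarith)
  set E := Real.exp (-2 * θ)
  set r := speed m n
  have g1 : θ * (n + expect (unif (m n)) n statistic + r * τ) ≤ θ * ((1 + ε) * r + r * τ) :=
    mul_le_mul_of_nonneg_left (by linarith) hθ
  have g2 : -(kappaAt m q n * (1 - E) / 2) ≤ -(kappa m q * (1 - E) / 2) + ε := by nlinarith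
  have g3 := mul_le_mul_of_nonneg_left g2 hr.le
  linarith

/-- Bounding the limsup below needs only infinitely many `n`: those with `kappaAt` near its liminf.
The strict inequality puts the tilted window below the threshold. -/
theorem rate_le_of_lt
    (hm_large : (fun n : ℕ => (n : ℝ)) =o[atTop] (fun n : ℕ => (m n : ℝ)))
    (hm_small : (fun n : ℕ => (m n : ℝ)) =o[atTop] (fun n : ℕ => (n : ℝ) ^ 2))
    (hq : ∀ n : ℕ, 1 ≤ n → q n ∈ boundedPmf γ (m n)) {τ θ : ℝ} (hθ : 0 < θ)
    (hτ : kappa m q * Real.exp (-2 * θ) < 1 + τ) :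
    rate m q τ ≤ ((-(θ * (kappa m q * Real.exp (-2 * θ))) +
      kappa m q * (1 - Real.exp (-2 * θ)) / 2 : ℝ) : EReal) := by
  rw [rate_eq_neg_limsup, EReal.neg_le, ← EReal.coe_neg]
  refine coe_le_of_forall_pos_sub_le (C := θ + 1) fun ε hε => ?_
  -- Half the gap is for the width of the window, the other half for the error in the mean excess.
  set δ := min ε ((1 + τ - kappa m q * Real.exp (-2 * θ)) / 2) with hδdef
  have hδ : 0 < δ := lt_min hε (by linarith)
  have hδ1 : δ ≤ ε := min_le_left _ _
  have hδ2 : δ ≤ (1 + τ - kappa m q * Real.exp (-2 * θ)) / 2 := min_le_right _ _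
  obtain ⟨η, hη, hev⟩ := eventually_le_prob_excess hm_large hm_small hq (kappa_nonneg hq) hθ hδ
  have hfreq : ∃ᶠ n in atTop, kappaAt m q n < kappa m q + η :=
    frequently_lt_of_liminf_lt (isBoundedUnder_kappaAt hq).isCoboundedUnder_ge
      (show liminf (kappaAt m q) atTop < kappa m q + η from lt_add_of_pos_right _ hη)
  refine le_limsup_of_frequently_le' (hfreq.mp ?_)
  filter_upwards [eventually_mem hq, hev, (tendsto_speed hm_small hq).eventually_gt_atTop 0,
    (tendsto_excess_mean hm_large hq).eventually_const_le (show 1 - δ < 1 by linarith),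
    eventually_lt_of_lt_liminf (show kappa m q - η < liminf (kappaAt m q) atTop from
      sub_lt_self _ hη) isBoundedUnder_ge_kappaAt] with n ⟨_, hqn⟩ h1 hr h2 h3 h4
  refine le_inv_mul_log hr ?_
  refine le_trans ?_ ((h1 (abs_le.2 ⟨by linarith, by linarith⟩)).trans
    (prob_mono hqn.1.1 fun z hz => ?_))
  · rw [Real.exp_le_exp]
    refine mul_le_mul_of_nonneg_left ?_ hr.le
    nlinarith
  · rw [le_div_iff₀ hr] at h2
    have hz' : excess z ≤ speed m n * (kappa m q * Real.exp (-2 * θ) + δ) := hz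
    have : speed m n * (kappa m q * Real.exp (-2 * θ) + δ) ≤ speed m n * (1 - δ + τ) :=
      mul_le_mul_of_nonneg_left (by linarith) hr.le
    change excess z ≤ _
    linarith

theorem rate_le_of_forall_lt
    (hm_large : (fun n : ℕ => (n : ℝ)) =o[atTop] (fun n : ℕ => (m n : ℝ)))
    (hm_small : (fun n : ℕ => (m n : ℝ)) =o[atTop] (fun n : ℕ => (n : ℝ) ^ 2))
    (hq : ∀ n : ℕ, 1 ≤ n → q n ∈ boundedPmf γ (m n)) {τ θ₀ : ℝ} (hθ₀ : 0 ≤ θ₀)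
    (hτ : ∀ θ > θ₀, kappa m q * Real.exp (-2 * θ) < 1 + τ) :
    rate m q τ ≤ ((-(θ₀ * (kappa m q * Real.exp (-2 * θ₀))) +
      kappa m q * (1 - Real.exp (-2 * θ₀)) / 2 : ℝ) : EReal) := by
  have hc : Continuous fun θ : ℝ => ((-(θ * (kappa m q * Real.exp (-2 * θ))) +
      kappa m q * (1 - Real.exp (-2 * θ)) / 2 : ℝ) : EReal) :=
    continuous_coe_real_ereal.comp (by fun_prop)
  refine ge_of_tendsto ((hc.tendsto θ₀).mono_left (nhdsWithin_le_nhds (s := Set.Ioi θ₀))) ?_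
  filter_upwards [self_mem_nhdsWithin] with θ hθ
  exact rate_le_of_lt hm_large hm_small hq (hθ₀.trans_lt hθ) (hτ θ hθ)

/-- The objective is concave in `θ`, with derivative `κ exp (-2θ) - (1 + τ)`. Its maximizer on `θ ≥
0` is `0` if `κ ≤ 1 + τ`, and the zero of the derivative otherwise. -/
theorem exists_rate_le
    (hm_large : (fun n : ℕ => (n : ℝ)) =o[atTop] (fun n : ℕ => (m n : ℝ)))
    (hm_small : (fun n : ℕ => (m n : ℝ)) =o[atTop] (fun n : ℕ => (n : ℝ) ^ 2))
    (hq : ∀ n : ℕ, 1 ≤ n → q n ∈ boundedPmf γ (m n)) {τ : ℝ} (hτ : -1 < τ) :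
    ∃ θ : ℝ, 0 ≤ θ ∧ rate m q τ ≤
      ((θ * (-1 - τ) - 1 / 2 * (Real.exp (-2 * θ) - 1) * kappa m q : ℝ) : EReal) := by
  have hκ := kappa_nonneg hq
  have hx : 0 < 1 + τ := by linarith
  rcases le_or_gt (kappa m q) (1 + τ) with h | h
  · refine ⟨0, le_rfl, (rate_le_of_forall_lt hm_large hm_small hq le_rfl fun θ hθ => ?_).trans ?_⟩
    · have : Real.exp (-2 * θ) < 1 := by
        rw [← Real.exp_zero]; exact Real.exp_lt_exp.2 (by linarith)
      rcases hκ.eq_or_lt with h0 | h0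
      · rw [← h0, zero_mul]; exact hx
      · nlinarith
    · simp
  · have hκ0 : 0 < kappa m q := hx.trans h
    have he : ∀ θ, θ = Real.log (kappa m q / (1 + τ)) / 2 →
        kappa m q * Real.exp (-2 * θ) = 1 + τ := fun θ hθ => by
      have : -2 * θ = -Real.log (kappa m q / (1 + τ)) := by rw [hθ]; ring
      rw [this, Real.exp_neg, Real.exp_log (div_pos hκ0 hx)]
      field_simp
    set θ₀ := Real.log (kappa m q / (1 + τ)) / 2 with hθ₀
    have hpos : 0 ≤ θ₀ :=
      div_nonneg (Real.log_nonneg ((one_le_div hx).2 h.le)) (by norm_num)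
    refine ⟨θ₀, hpos, (rate_le_of_forall_lt hm_large hm_small hq hpos fun θ hθ => ?_).trans ?_⟩
    · rw [← he θ₀ rfl]
      exact mul_lt_mul_of_pos_left (Real.exp_lt_exp.2 (by linarith [show θ₀ < θ from hθ])) hκ0
    · rw [EReal.coe_le_coe_iff, he θ₀ rfl]
      linarith

end

end Coincidence

theorem mainTheorem4 (m : ℕ → ℕ)
    (hm_large : (fun n : ℕ => (n : ℝ)) =o[Filter.atTop] (fun n : ℕ => (m n : ℝ)))
    (hm_small : (fun n : ℕ => (m n : ℝ)) =o[Filter.atTop] (fun n : ℕ => (n : ℝ) ^ 2))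
    (γ : ℝ) (q : (n : ℕ) → Fin (m n) → ℝ)
    (hq : ∀ n : ℕ, 1 ≤ n → q n ∈ Coincidence.boundedPmf γ (m n))
    (τ : ℝ) (hτ : τ ≠ -1) :
    Coincidence.rate m q τ =
      ⨆ θ : {θ : ℝ // 0 ≤ θ},
        ((θ.1 * (-1 - τ) - 1 / 2 * (Real.exp (-2 * θ.1) - 1) * Coincidence.kappa m q : ℝ) :
          EReal) := by
  refine le_antisymm ?_
    (iSup_le fun θ => Coincidence.le_rate hm_large hm_small hq τ θ.2)
  rcases lt_or_gt_of_ne hτ with h | h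
  · refine le_top.trans_eq (Eq.symm ?_)
    rw [EReal.eq_top_iff_forall_lt]
    intro y
    have hκ := Coincidence.kappa_nonneg hq
    have hpos : 0 < -1 - τ := by linarith
    -- This `θ` makes the linear term `|y| + 1`; the remaining term is nonnegative.
    have hθ : 0 ≤ (|y| + 1) / (-1 - τ) := by positivity
    refine lt_of_lt_of_le ?_ (le_iSup _ ⟨(|y| + 1) / (-1 - τ), hθ⟩)
    rw [EReal.coe_lt_coe_iff, div_mul_cancel₀ _ hpos.ne']
    have hE : Real.exp (-2 * ((|y| + 1) / (-1 - τ))) ≤ 1 := Real.exp_le_one_iff.2 (by linarith)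
    nlinarith [le_abs_self y]
  · obtain ⟨θ, hθ, hle⟩ := Coincidence.exists_rate_le hm_large hm_small hq h
    exact hle.trans (le_iSup (fun θ : {θ : ℝ // 0 ≤ θ} =>
      ((θ.1 * (-1 - τ) - 1 / 2 * (Real.exp (-2 * θ.1) - 1) * Coincidence.kappa m q : ℝ) :
        EReal)) ⟨θ, hθ⟩)
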